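/- \textbf{Theorem (Entropy Net for Spectraplex).} For a positive integer $m$ let $\mathcal{S}_m := \{X \in \mathbb{R}^{m \times m} : X = X^\top,\ X \succeq 0,\ \mathrm{tr}(X) = 1\}$ be the spectraplex, and for a positive integer $h$ dividing $m$ let $\mathcal{S}_m^h \subseteq \mathcal{S}_m$ be the set of those $X \in \mathcal{S}_m$ that are block diagonal with $m/h$ consecutive diagonal blocks of size $h \times h$. For $X, Y \in \mathcal{S}_m$ let $S(X \| Y) := \mathrm{tr}(X(\log X - \log Y))$ be the quantum relative entropy, where $\log$ is the natural logarithm, $0 \log 0 = 0$, and $S(X \| Y) = +\infty$ if $\ker Y \not\subseteq \ker X$. A set $T \subseteq \mathcal{S}_m$ is called a relative entropy net of $\mathcal{M} \subseteq \mathcal{S}_m$ with error $\varepsilon$ if for every $X \in \mathcal{M}$ there is $Y \in T$ with $S(X \| Y) \le \varepsilon$. There is a universal constant $C > 0$ such that for all positive integers $h, m, n$ with $h \mid m$ there is a finite set $T \subseteq \mathcal{S}_m$ that is a relative entropy net of $\mathcal{S}_m^h$ with error $\max(1, \log(2hm/n))$ and has size $|T| \le 2^{Cn}$. -/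

import Mathlib

open scoped Classical in
/-- The quantum relative entropy `S(X ‖ Y) = tr (X (log X - log Y))` of two positive semidefinite
real matrices, with values in `[-∞, ∞]`. The logarithm is that of the functional calculus, with
`log 0 = 0` on the kernel: for `X` this is the convention `0 log 0 = 0`, and if
`ker Y ⊆ ker X` then the kernel of `Y` does not contribute to `tr (X log Y)`. If
`ker Y ⊄ ker X`, then the relative entropy is `+∞`. -/
noncomputable def quantumRelEntropy {m : ℕ} (X Y : Matrix (Fin m) (Fin m) ℝ) : EReal :=
  if ∀ v : Fin m → ℝ, Matrix.mulVec Y v = 0 → Matrix.mulVec X v = 0 then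
    ((Matrix.trace (X * (cfc Real.log X - cfc Real.log Y)) : ℝ) : EReal)
  else ⊤

/-- The spectraplex: the real symmetric positive semidefinite `m × m` matrices of trace one. -/
def spectraplex (m : ℕ) : Set (Matrix (Fin m) (Fin m) ℝ) :=
  {X | X.PosSemidef ∧ X.trace = 1}

/-- The block diagonal matrices of the spectraplex with block size `h × h` (for `h ∣ m`): the
index `i` lies in the block number `i / h`, and entries between different blocks vanish. -/
def blockSpectraplex (m h : ℕ) : Set (Matrix (Fin m) (Fin m) ℝ) :=
  {X | X ∈ spectraplex m ∧ ∀ i j : Fin m, (i : ℕ) / h ≠ (j : ℕ) / h → X i j = 0}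

/-- `T` is a (quantum) relative entropy net of `M` with error `ε`; both are subsets of the
spectraplex. -/
def IsRelEntropyNet {m : ℕ} (T M : Set (Matrix (Fin m) (Fin m) ℝ)) (ε : ℝ) : Prop :=
  T ⊆ spectraplex m ∧ M ⊆ spectraplex m ∧
    ∀ X ∈ M, ∃ Y ∈ T, quantumRelEntropy X Y ≤ (ε : EReal)

/-! If `X ≤ τ Y` in the Loewner order then `S(X ‖ Y) ≤ log τ`, by
`Matrix.PosSemidef.trace_mul_log_sub_log_le`. So it suffices to find few block diagonal majorants `Z
≥ X` of small trace and to normalize them (`exists_relEntropyNet_of_majorants`). Write `m = k * h`;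
the traces of the blocks of `X` form a probability vector on `k` points.

For `n < m`, use `tr(X_b) • 1 ≥ X_b`, with one common coefficient for each group of about `m / n`
consecutive blocks. Only the group weights, rounded up to multiples of `1 / G` with `G` the number
of groups, have to be counted.

For `n ≥ m`, round the block traces up to `s_b / r` with `r` of order `n / h`, and factor each block
as `Bᵀ B`. After scaling, `B` lies in the Frobenius unit ball; a net of this ball in operator norm
with squared error `O(1 / s_b)` has `exp(O(h s_b))` points. Replacing `B` by a net point costs a
constant factor and an additive `O(1 / r)` times the identity. The exponents sum to `O(h (r + k)) =
O(n)`.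

The net carries the weight (`exists_finset_frobNorm_l2OpNorm_cover`). A volume bound for low rank
matrices at the final accuracy would lose a logarithm. Instead, each scale fixes the low rank part
only to constant relative Frobenius accuracy and passes the smaller remainder to the next coarser
scale, so the costs form a geometric sum. -/

open Matrix

/-! ### Relative entropy and the Loewner order -/

/-- Spectral theorem for real symmetric matrices, together with the resulting formula for the
functional calculus. -/
theorem Matrix.IsHermitian.exists_orthogonal_diagonalization {n : Type*} [Fintype n] [DecidableEq n]
    {A : Matrix n n ℝ} (hA : A.IsHermitian) :
    ∃ V : Matrix n n ℝ, Vᵀ * V = 1 ∧ V * Vᵀ = 1 ∧ A = V * diagonal hA.eigenvalues * Vᵀ ∧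
      ∀ f : ℝ → ℝ, cfc f A = V * diagonal (fun i => f (hA.eigenvalues i)) * Vᵀ := by
  have hs : star (hA.eigenvectorUnitary : Matrix n n ℝ) =
      (hA.eigenvectorUnitary : Matrix n n ℝ)ᵀ := by
    rw [star_eq_conjTranspose, conjTranspose_eq_transpose_of_trivial]
  refine ⟨hA.eigenvectorUnitary, ?_, ?_, ?_, fun f => ?_⟩
  · rw [← hs]; exact Unitary.coe_star_mul_self _
  · rw [← hs]; exact Unitary.coe_mul_star_self _
  · conv_lhs => rw [hA.spectral_theorem, Unitary.conjStarAlgAut_apply]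
    rw [← hs]; rfl
  · rw [hA.cfc_eq, Matrix.IsHermitian.cfc, Unitary.conjStarAlgAut_apply, ← hs]; rfl

theorem Matrix.trace_conj_diagonal_mul_conj_diagonal {n : Type*} [Fintype n] [DecidableEq n]
    (V W : Matrix n n ℝ) (a b : n → ℝ) :
    ((V * diagonal a * Vᵀ) * (W * diagonal b * Wᵀ)).trace =
      ∑ i, a i * ∑ j, (Wᵀ * V) j i ^ 2 * b j := by
  have h : ((V * diagonal a * Vᵀ) * (W * diagonal b * Wᵀ)).trace =
      (diagonal a * ((Wᵀ * V)ᵀ * (diagonal b * (Wᵀ * V)))).trace := by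
    rw [transpose_mul, transpose_transpose]
    simp only [Matrix.mul_assoc]
    rw [Matrix.trace_mul_comm]
    simp only [Matrix.mul_assoc]
  rw [h, trace]
  refine Finset.sum_congr rfl fun i _ => ?_
  rw [diag_apply, diagonal_mul, mul_apply]
  congr 1
  refine Finset.sum_congr rfl fun j _ => ?_
  rw [diagonal_mul, transpose_apply]; ring

/-- The tangent at `z = a` of `log` as a function of `1 / z`; averaging it over `z` plays the part
of Jensen's inequality. -/
theorem Real.log_tangent_lower_bound {a z : ℝ} (ha : 0 < a) (hz : 0 < z) :
    Real.log a + 1 - a / z ≤ Real.log z := by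
  have := Real.log_le_sub_one_of_pos (div_pos ha hz)
  rw [Real.log_div ha.ne' hz.ne'] at this
  linarith

/-- If `X ≤ τ Y` in the Loewner order, `X` has trace one and `Y` is positive definite, then the
relative entropy of `X` with respect to `Y` is at most `log τ`. -/
theorem Matrix.PosSemidef.trace_mul_log_sub_log_le {n : Type*} [Fintype n] [DecidableEq n]
    {X Y : Matrix n n ℝ} (hX : X.PosSemidef) (hX1 : X.trace = 1) (hY : Y.PosDef) {τ : ℝ}
    (hτ : 0 < τ) (hXY : (τ • Y - X).PosSemidef) :
    (X * (cfc Real.log X - cfc Real.log Y)).trace ≤ Real.log τ := by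
  obtain ⟨V, hV, hV', hXV, hXf⟩ := hX.isHermitian.exists_orthogonal_diagonalization
  obtain ⟨W, hW, hW', hYW, hYf⟩ := hY.isHermitian.exists_orthogonal_diagonalization
  set l := hX.isHermitian.eigenvalues with hl
  set u := hY.isHermitian.eigenvalues with hu
  have hl0 : ∀ i, 0 ≤ l i := hX.eigenvalues_nonneg
  have hu0 : ∀ i, 0 < u i := hY.eigenvalues_pos
  have hl1 : ∑ i, l i = 1 := by
    have := hX.isHermitian.trace_eq_sum_eigenvalues
    rw [hX1] at this
    simpa using this.symm
  set P := Wᵀ * V with hP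
  have hPP : Pᵀ * P = 1 := by
    rw [hP, transpose_mul, transpose_transpose, Matrix.mul_assoc, ← Matrix.mul_assoc W, hW',
      Matrix.one_mul, hV]
  have hcol : ∀ i, ∑ j, P j i ^ 2 = 1 := fun i => by
    have := congrFun (congrFun hPP i) i
    rw [mul_apply, one_apply_eq] at this
    rw [← this]
    exact Finset.sum_congr rfl fun j _ => by rw [transpose_apply]; ring
  -- The hypothesis `X ≤ τ Y` written in the eigenbasis of `Y`.
  have hconj : (diagonal (fun j => τ * u j) - P * diagonal l * Pᵀ).PosSemidef := by
    have := hXY.conjTranspose_mul_mul_same W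
    convert this using 1
    rw [conjTranspose_eq_transpose_of_trivial, hXV, hYW, hP]
    have e1 : Wᵀ * (τ • (W * diagonal u * Wᵀ)) * W = diagonal (fun j => τ * u j) := by
      rw [Matrix.mul_smul, Matrix.smul_mul]
      simp only [← Matrix.mul_assoc]
      rw [hW, Matrix.one_mul, Matrix.mul_assoc, hW, Matrix.mul_one, ← diagonal_smul]
      rfl
    rw [Matrix.mul_sub, Matrix.sub_mul, e1, transpose_mul, transpose_transpose]
    simp only [Matrix.mul_assoc]
  -- Test with `Y⁻¹` applied to the `i`-th eigenvector of `X`. Keeping only the `i`-th term on the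
  -- side of `X` gives `l i * S ^ 2 ≤ τ * S`.
  have hS : ∀ i, 0 < l i → l i * ∑ j, P j i ^ 2 / u j ≤ τ := by
    intro i hi
    set S := ∑ j, P j i ^ 2 / u j with hSdef
    have hS0 : 0 ≤ S := Finset.sum_nonneg fun j _ => div_nonneg (sq_nonneg _) (hu0 j).le
    have hq := hconj.dotProduct_mulVec_nonneg (fun j => P j i / u j)
    rw [star_trivial, sub_mulVec, dotProduct_sub] at hq
    have h1 : (fun j => P j i / u j) ⬝ᵥ (diagonal (fun j => τ * u j) *ᵥ fun j => P j i / u j) =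
        τ * S := by
      rw [dotProduct, hSdef, Finset.mul_sum]
      refine Finset.sum_congr rfl fun j _ => ?_
      rw [mulVec_diagonal]
      have := (hu0 j).ne'
      field_simp
    have h2 : (fun j => P j i / u j) ⬝ᵥ ((P * diagonal l * Pᵀ) *ᵥ fun j => P j i / u j) =
        ∑ k, l k * (∑ j, P j k * (P j i / u j)) ^ 2 := by
      rw [← mulVec_mulVec, ← mulVec_mulVec, dotProduct_mulVec, ← mulVec_transpose, dotProduct]
      refine Finset.sum_congr rfl fun k _ => ?_
      rw [mulVec_diagonal]
      simp only [mulVec, dotProduct, transpose_apply]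
      ring
    have h3 : l i * S ^ 2 ≤ ∑ k, l k * (∑ j, P j k * (P j i / u j)) ^ 2 := by
      refine le_trans (le_of_eq ?_) (Finset.single_le_sum
        (f := fun k => l k * (∑ j, P j k * (P j i / u j)) ^ 2)
        (fun k _ => mul_nonneg (hl0 k) (sq_nonneg _)) (Finset.mem_univ i))
      simp only [hSdef]
      congr 3
      funext j
      ring
    rw [h1, h2] at hq
    rcases hS0.eq_or_lt with h0 | h0
    · rw [← h0, mul_zero]; exact hτ.le
    · have : (l i * S) * S ≤ τ * S := by nlinarith
      exact le_of_mul_le_mul_right this h0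
  have hmain : ∀ i, l i * Real.log (l i) - l i * ∑ j, P j i ^ 2 * Real.log (u j) ≤
      l i * Real.log τ := by
    intro i
    rcases (hl0 i).eq_or_lt with h0 | h0
    · simp [← h0]
    -- The tangent is taken at `l i / τ`: averaged with weights `P j i ^ 2`, its correction is `1 -
    -- l i * S / τ`, nonnegative by `hS`.
    · have ha : 0 < l i / τ := div_pos h0 hτ
      have h1 : ∑ j, P j i ^ 2 * (Real.log (l i / τ) + 1 - l i / τ / u j) ≤
          ∑ j, P j i ^ 2 * Real.log (u j) :=
        Finset.sum_le_sum fun j _ =>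
          mul_le_mul_of_nonneg_left (Real.log_tangent_lower_bound ha (hu0 j)) (sq_nonneg _)
      have h2 : ∑ j, P j i ^ 2 * (Real.log (l i / τ) + 1 - l i / τ / u j) =
          Real.log (l i / τ) + 1 - (l i * ∑ j, P j i ^ 2 / u j) / τ := by
        simp only [mul_sub, Finset.sum_sub_distrib, ← Finset.sum_mul, hcol, one_mul]
        congr 1
        rw [Finset.mul_sum, Finset.sum_div]
        exact Finset.sum_congr rfl fun j _ => by ring
      have h3 : (l i * ∑ j, P j i ^ 2 / u j) / τ ≤ 1 := (div_le_one hτ).2 (hS i h0)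
      have h4 : Real.log (l i / τ) ≤ ∑ j, P j i ^ 2 * Real.log (u j) := by linarith
      rw [Real.log_div h0.ne' hτ.ne'] at h4
      nlinarith
  have e1 : (X * cfc Real.log X).trace = ∑ i, l i * Real.log (l i) := by
    rw [hXf]
    conv_lhs => rw [hXV]
    rw [trace_conj_diagonal_mul_conj_diagonal, hV]
    refine Finset.sum_congr rfl fun i _ => ?_
    congr 1
    rw [Finset.sum_eq_single i (fun j _ hj => by simp [one_apply_ne hj]) (by simp)]
    simp
  have e2 : (X * cfc Real.log Y).trace = ∑ i, l i * ∑ j, P j i ^ 2 * Real.log (u j) := by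
    rw [hYf]
    conv_lhs => rw [hXV]
    rw [trace_conj_diagonal_mul_conj_diagonal]
  rw [Matrix.mul_sub, trace_sub, e1, e2, ← Finset.sum_sub_distrib]
  calc _ ≤ ∑ i, l i * Real.log τ := Finset.sum_le_sum fun i _ => hmain i
    _ = Real.log τ := by rw [← Finset.sum_mul, hl1, one_mul]

theorem quantumRelEntropy_le_log {m : ℕ} {X Y : Matrix (Fin m) (Fin m) ℝ}
    (hX : X ∈ spectraplex m) (hY : Y.PosDef) {τ : ℝ} (hτ : 0 < τ)
    (hXY : (τ • Y - X).PosSemidef) : quantumRelEntropy X Y ≤ (Real.log τ : EReal) := by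
  have hker : ∀ v : Fin m → ℝ, Matrix.mulVec Y v = 0 → Matrix.mulVec X v = 0 := by
    intro v hv
    have : v = 0 := by
      by_contra hne
      have := hY.dotProduct_mulVec_pos hne
      simp [hv] at this
    simp [this]
  rw [quantumRelEntropy, if_pos hker]
  exact EReal.coe_le_coe_iff.2 (hX.1.trace_mul_log_sub_log_le hX.2 hY hτ hXY)

/-! ### Block diagonal matrices, and nets from majorants -/

section BlockDiagonal

variable {n o : Type*} [DecidableEq o]

theorem Matrix.IsHermitian.blockDiagonal {Z : o → Matrix n n ℝ} (hZ : ∀ b, (Z b).IsHermitian) :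
    (blockDiagonal Z).IsHermitian := by
  rw [IsHermitian, blockDiagonal_conjTranspose]
  congr 1
  funext b
  exact hZ b

variable [Fintype n] [Fintype o]

theorem Matrix.dotProduct_blockDiagonal_mulVec (Z : o → Matrix n n ℝ) (x : n × o → ℝ) :
    x ⬝ᵥ (blockDiagonal Z *ᵥ x) =
      ∑ b, (fun i => x (i, b)) ⬝ᵥ (Z b *ᵥ fun i => x (i, b)) := by
  simp only [dotProduct, mulVec, Fintype.sum_prod_type, blockDiagonal_apply, ite_mul, zero_mul,
    Finset.sum_ite_eq, Finset.mem_univ, if_true]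
  rw [Finset.sum_comm]

theorem Matrix.PosSemidef.blockDiagonal {Z : o → Matrix n n ℝ} (hZ : ∀ b, (Z b).PosSemidef) :
    (blockDiagonal Z).PosSemidef := by
  refine .of_dotProduct_mulVec_nonneg (.blockDiagonal fun b => (hZ b).isHermitian) fun x => ?_
  rw [star_trivial, dotProduct_blockDiagonal_mulVec]
  exact Finset.sum_nonneg fun b _ => by
    simpa using (hZ b).dotProduct_mulVec_nonneg fun i => x (i, b)

theorem Matrix.PosDef.blockDiagonal {Z : o → Matrix n n ℝ} (hZ : ∀ b, (Z b).PosDef) :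
    (blockDiagonal Z).PosDef := by
  refine .of_dotProduct_mulVec_pos (.blockDiagonal fun b => (hZ b).isHermitian) fun x hx => ?_
  rw [star_trivial, dotProduct_blockDiagonal_mulVec]
  obtain ⟨⟨i, b⟩, hib⟩ := Function.ne_iff.1 hx
  refine Finset.sum_pos' (fun b _ => by
    simpa using (hZ b).posSemidef.dotProduct_mulVec_nonneg fun i => x (i, b))
    ⟨b, Finset.mem_univ b, ?_⟩
  have : (fun i => x (i, b)) ≠ 0 := fun h => hib (congrFun h i)
  simpa using (hZ b).dotProduct_mulVec_pos this

end BlockDiagonal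

/-- The position inside its block and the block number of an index of a block matrix with `k`
consecutive blocks of size `h`. -/
def blockIndexEquiv (k h : ℕ) : Fin (k * h) ≃ Fin h × Fin k :=
  finProdFinEquiv.symm.trans (Equiv.prodComm _ _)

/-- The block diagonal matrix with the given consecutive diagonal blocks. -/
def assembleBlocks {k h : ℕ} (Z : Fin k → Matrix (Fin h) (Fin h) ℝ) :
    Matrix (Fin (k * h)) (Fin (k * h)) ℝ :=
  (blockDiagonal Z).submatrix (blockIndexEquiv k h) (blockIndexEquiv k h)

theorem trace_assembleBlocks {k h : ℕ} (Z : Fin k → Matrix (Fin h) (Fin h) ℝ) :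
    (assembleBlocks Z).trace = ∑ b, (Z b).trace := by
  rw [← trace_blockDiagonal, assembleBlocks, trace, trace]
  exact Equiv.sum_comp (blockIndexEquiv k h) fun i => (blockDiagonal Z).diag i

theorem assembleBlocks_sub {k h : ℕ} (Z X : Fin k → Matrix (Fin h) (Fin h) ℝ) :
    assembleBlocks Z - assembleBlocks X = assembleBlocks fun b => Z b - X b := by
  ext i j
  change blockDiagonal Z _ _ - blockDiagonal X _ _ = blockDiagonal (fun b => Z b - X b) _ _
  rw [← Matrix.sub_apply, ← blockDiagonal_sub]
  rfl

theorem exists_eq_assembleBlocks {k h : ℕ} {X : Matrix (Fin (k * h)) (Fin (k * h)) ℝ}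
    (hX : X ∈ blockSpectraplex (k * h) h) :
    ∃ B : Fin k → Matrix (Fin h) (Fin h) ℝ,
      (∀ b, (B b).PosSemidef) ∧ ∑ b, (B b).trace = 1 ∧ assembleBlocks B = X := by
  let B : Fin k → Matrix (Fin h) (Fin h) ℝ := fun b =>
    X.submatrix (fun i => (blockIndexEquiv k h).symm (i, b))
      (fun i => (blockIndexEquiv k h).symm (i, b))
  have hB : assembleBlocks B = X := by
    ext i j
    obtain ⟨⟨a, b⟩, rfl⟩ := (blockIndexEquiv k h).symm.surjective i
    obtain ⟨⟨a', b'⟩, rfl⟩ := (blockIndexEquiv k h).symm.surjective j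
    rw [assembleBlocks, submatrix_apply, Equiv.apply_symm_apply, Equiv.apply_symm_apply,
      blockDiagonal_apply]
    by_cases hb : b = b'
    · subst hb; simp [B]
    · rw [if_neg hb]
      refine (hX.2 _ _ fun hdiv => hb (Fin.ext ?_)).symm
      have key : ∀ (a : Fin h) (b : Fin k),
          (((blockIndexEquiv k h).symm (a, b) : Fin (k * h)) : ℕ) / h = b := fun a b => by
        change ((a : ℕ) + h * b) / h = b
        rw [Nat.add_mul_div_left _ _ a.pos, Nat.div_eq_of_lt a.2, zero_add]
      rwa [key, key] at hdiv
  refine ⟨B, fun b => hX.1.1.submatrix _, ?_, hB⟩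
  rw [← trace_assembleBlocks, hB, hX.1.2]

/-- A finite family of block diagonal matrices that majorizes every block diagonal matrix of the
spectraplex by one of trace at most `τ` gives, after normalization, a relative entropy net with
error `log τ`. -/
theorem exists_relEntropyNet_of_majorants {k h : ℕ}
    (N : Finset (Fin k → Matrix (Fin h) (Fin h) ℝ)) {τ ε : ℝ} (hε : Real.log τ ≤ ε)
    (H : ∀ X : Fin k → Matrix (Fin h) (Fin h) ℝ, (∀ b, (X b).PosSemidef) →
      ∑ b, (X b).trace = 1 → ∃ Z ∈ N, (∀ b, (Z b).PosDef) ∧ (∀ b, (Z b - X b).PosSemidef) ∧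
        ∑ b, (Z b).trace ≤ τ) :
    ∃ T : Finset (Matrix (Fin (k * h)) (Fin (k * h)) ℝ),
      IsRelEntropyNet (T : Set (Matrix (Fin (k * h)) (Fin (k * h)) ℝ))
        (blockSpectraplex (k * h) h) ε ∧ T.card ≤ N.card := by
  classical
  refine ⟨(N.filter fun Z => (∀ b, (Z b).PosDef) ∧ 0 < ∑ b, (Z b).trace).image
    fun Z => (∑ b, (Z b).trace)⁻¹ • assembleBlocks Z, ⟨?_, fun X hX => hX.1, ?_⟩,
    Finset.card_image_le.trans (Finset.card_filter_le _ _)⟩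
  · intro Y hY
    simp only [Finset.coe_image, Set.mem_image, Finset.mem_coe, Finset.mem_filter] at hY
    obtain ⟨Z, ⟨-, hZ, hpos⟩, rfl⟩ := hY
    refine ⟨(((PosSemidef.blockDiagonal fun b => (hZ b).posSemidef).submatrix _)).smul
      (inv_nonneg.2 hpos.le), ?_⟩
    rw [trace_smul, trace_assembleBlocks, smul_eq_mul, inv_mul_cancel₀ hpos.ne']
  · intro X hX
    obtain ⟨B, hB, hB1, rfl⟩ := exists_eq_assembleBlocks hX
    obtain ⟨Z, hZN, hZ, hZB, hZτ⟩ := H B hB hB1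
    have hge : 1 ≤ ∑ b, (Z b).trace := by
      rw [← hB1]
      refine Finset.sum_le_sum fun b _ => ?_
      have := (hZB b).trace_nonneg
      rw [trace_sub] at this
      linarith
    have hpos : 0 < ∑ b, (Z b).trace := by linarith
    refine ⟨(∑ b, (Z b).trace)⁻¹ • assembleBlocks Z, ?_, ?_⟩
    · simp only [Finset.coe_image, Set.mem_image, Finset.mem_coe, Finset.mem_filter]
      exact ⟨Z, ⟨hZN, hZ, hpos⟩, rfl⟩
    · refine (quantumRelEntropy_le_log hX.1 ?_ hpos ?_).trans
        (EReal.coe_le_coe_iff.2 ((Real.log_le_log hpos hZτ).trans hε))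
      · exact ((PosDef.blockDiagonal hZ).submatrix (blockIndexEquiv k h).injective).smul
          (inv_pos.2 hpos)
      · rw [smul_smul, mul_inv_cancel₀ hpos.ne', one_smul, assembleBlocks_sub]
        exact (PosSemidef.blockDiagonal hZB).submatrix _

/-! ### Rounded traces and the net for `n < m` -/

/-- There are at most `2 ^ (R + card ι)` families of natural numbers indexed by `ι` with sum at
most `R`. -/
theorem exists_finset_sum_le (ι : Type*) [Fintype ι] [DecidableEq ι] (R : ℕ) :
    ∃ S : Finset (ι → ℕ), (∀ s, s ∈ S ↔ ∑ i, s i ≤ R) ∧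
      S.card ≤ 2 ^ (R + Fintype.card ι) := by
  refine ⟨(Fintype.piFinset fun _ => Finset.range (R + 1)).filter fun s => ∑ i, s i ≤ R,
    fun s => ?_, ?_⟩
  · rw [Finset.mem_filter, Fintype.mem_piFinset, and_iff_right_iff_imp]
    intro hs i
    rw [Finset.mem_range, Nat.lt_succ_iff]
    exact (Finset.single_le_sum (fun _ _ => Nat.zero_le _) (Finset.mem_univ i)).trans hs
  · set P := Fintype.piFinset fun _ : ι => Finset.range (R + 1)
    set S := P.filter fun s => ∑ i, s i ≤ R
    -- Generating function at `1 / 2`: each family in `S` has weight at least `2 ^ (-R)`, and over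
    -- the whole box the weights factor into geometric sums, each at most `2`.
    have h1 : (S.card : ℝ) * (1 / 2) ^ R ≤ ∑ s ∈ S, ∏ i, (1 / 2 : ℝ) ^ s i := by
      rw [← nsmul_eq_mul]
      refine Finset.card_nsmul_le_sum _ _ _ fun s hs => ?_
      rw [Finset.prod_pow_eq_pow_sum]
      exact pow_le_pow_of_le_one (by norm_num) (by norm_num) (Finset.mem_filter.1 hs).2
    have h2 : ∑ s ∈ S, ∏ i, (1 / 2 : ℝ) ^ s i ≤ ∑ s ∈ P, ∏ i, (1 / 2 : ℝ) ^ s i :=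
      Finset.sum_le_sum_of_subset_of_nonneg (Finset.filter_subset _ _) fun s _ _ => by positivity
    have h3 : ∑ s ∈ P, ∏ i, (1 / 2 : ℝ) ^ s i ≤ 2 ^ Fintype.card ι := by
      rw [← Finset.prod_univ_sum (fun _ : ι => Finset.range (R + 1)) fun _ j => (1 / 2 : ℝ) ^ j]
      rw [Finset.prod_const, Finset.card_univ]
      refine pow_le_pow_left₀ (Finset.sum_nonneg fun _ _ => by positivity) ?_ _
      exact sum_geometric_two_le _
    have h4 : (S.card : ℝ) ≤ 2 ^ (R + Fintype.card ι) := by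
      rw [pow_add]
      have : (S.card : ℝ) = 2 ^ R * (S.card * (1 / 2) ^ R) := by
        rw [mul_comm, mul_assoc, ← mul_pow]; norm_num
      rw [this]
      exact mul_le_mul_of_nonneg_left (h1.trans (h2.trans h3)) (by positivity)
    exact_mod_cast h4

/-- Rounding up nonnegative weights of total mass one to positive integer multiples of `1 / r`. -/
theorem exists_nat_weights {ι : Type*} [Fintype ι] {t : ι → ℝ} (ht : ∀ i, 0 ≤ t i)
    (ht1 : ∑ i, t i = 1) (r : ℕ) :
    ∃ s : ι → ℕ, (∀ i, 0 < s i) ∧ ∑ i, s i ≤ r + Fintype.card ι ∧ ∀ i, r * t i ≤ s i := by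
  -- Floor plus one, not the ceiling: the weights must be positive even where `t i = 0`, to make the
  -- majorants positive definite.
  refine ⟨fun i => ⌊r * t i⌋₊ + 1, fun i => Nat.succ_pos _, ?_, fun i => ?_⟩
  · rw [Finset.sum_add_distrib, Finset.sum_const, Finset.card_univ, smul_eq_mul, mul_one]
    refine Nat.add_le_add_right ?_ _
    have : ((∑ i, ⌊r * t i⌋₊ : ℕ) : ℝ) ≤ r := by
      push_cast
      calc _ ≤ ∑ i, r * t i := Finset.sum_le_sum fun i _ =>
            Nat.floor_le (mul_nonneg (Nat.cast_nonneg _) (ht i))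
        _ = r := by rw [← Finset.mul_sum, ht1, mul_one]
    exact_mod_cast this
  · push_cast
    exact (Nat.lt_floor_add_one _).le

/-- A positive semidefinite matrix is at most its trace times the identity. -/
theorem Matrix.PosSemidef.smul_one_sub_of_trace_le {n : Type*} [Fintype n] [DecidableEq n]
    {X : Matrix n n ℝ} (hX : X.PosSemidef) {c : ℝ} (hc : X.trace ≤ c) :
    (c • (1 : Matrix n n ℝ) - X).PosSemidef := by
  obtain ⟨V, hV, hV', hXV, -⟩ := hX.isHermitian.exists_orthogonal_diagonalization
  have e : c • (1 : Matrix n n ℝ) - X =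
      V * diagonal (fun i => c - hX.isHermitian.eigenvalues i) * Vᴴ := by
    rw [conjTranspose_eq_transpose_of_trivial]
    conv_lhs => rw [hXV]
    have : (diagonal fun i => c - hX.isHermitian.eigenvalues i) =
        c • (1 : Matrix n n ℝ) - diagonal hX.isHermitian.eigenvalues := by
      rw [smul_one_eq_diagonal, diagonal_sub]
    rw [this, Matrix.mul_sub, Matrix.sub_mul, Matrix.mul_smul, Matrix.smul_mul, Matrix.mul_one,
      hV']
  rw [e]
  refine PosSemidef.mul_mul_conjTranspose_same (PosSemidef.diagonal fun i => ?_) V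
  have h1 : X.trace = ∑ i, hX.isHermitian.eigenvalues i := by
    simpa using hX.isHermitian.trace_eq_sum_eigenvalues
  have h2 := Finset.single_le_sum (f := hX.isHermitian.eigenvalues)
    (fun j _ => hX.eigenvalues_nonneg j) (Finset.mem_univ i)
  simp only [Pi.zero_apply]
  linarith

theorem card_fin_div_eq_le (k : ℕ) {q : ℕ} (hq : 0 < q) (c : ℕ) :
    (Finset.univ.filter fun b : Fin k => (b : ℕ) / q = c).card ≤ q := by
  have : (Finset.univ.filter fun b : Fin k => (b : ℕ) / q = c).card ≤
      (Finset.range q).card := by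
    refine Finset.card_le_card_of_injOn (fun b => (b : ℕ) % q)
      (fun b _ => by simpa using Nat.mod_lt _ hq) fun a ha b hb hab => ?_
    simp only [Finset.coe_filter, Finset.mem_univ, true_and, Set.mem_ofPred_eq] at ha hb
    refine Fin.ext ?_
    rw [← Nat.div_add_mod (a : ℕ) q, ← Nat.div_add_mod (b : ℕ) q, ha, hb]
    exact congrArg _ hab
  simpa using this

/-- Nets made of matrices that are constant multiples of the identity on groups of `q` consecutive
blocks. -/
theorem exists_relEntropyNet_of_grouping {k h q : ℕ} (hh : 0 < h) (hq : 0 < q) {ε : ℝ}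
    (hε : Real.log (2 * h * q) ≤ ε) :
    ∃ T : Finset (Matrix (Fin (k * h)) (Fin (k * h)) ℝ),
      IsRelEntropyNet (T : Set (Matrix (Fin (k * h)) (Fin (k * h)) ℝ))
        (blockSpectraplex (k * h) h) ε ∧ T.card ≤ 2 ^ (3 * (k / q + 1)) := by
  classical
  set G := k / q + 1 with hG
  let g : Fin k → Fin G := fun b =>
    ⟨(b : ℕ) / q, Nat.lt_succ_of_le (Nat.div_le_div_right b.2.le)⟩
  -- Rounding at resolution `1 / G` at most doubles the total mass; this is the factor `2` in `2 * h
  -- * q`.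
  obtain ⟨S, hS, hScard⟩ := exists_finset_sum_le (Fin G) (G + G)
  let F : (Fin G → ℕ) → Fin k → Matrix (Fin h) (Fin h) ℝ := fun s b => ((s (g b) : ℝ) / G) • 1
  have hGpos : (0 : ℝ) < G := by rw [hG]; positivity
  obtain ⟨T, hT, hTcard⟩ := exists_relEntropyNet_of_majorants (S.image F) hε (by
    intro X hX hX1
    let t : Fin G → ℝ := fun c => ∑ b with g b = c, (X b).trace
    have ht0 : ∀ c, 0 ≤ t c := fun c => Finset.sum_nonneg fun b _ => (hX b).trace_nonneg
    have ht1 : ∑ c, t c = 1 := by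
      rw [← hX1]
      exact Finset.sum_fiberwise _ _ _
    obtain ⟨s, hs0, hs, hst⟩ := exists_nat_weights ht0 ht1 G
    rw [Fintype.card_fin] at hs
    refine ⟨F s, Finset.mem_image_of_mem _ ((hS s).2 hs), fun b => ?_, fun b => ?_, ?_⟩
    · exact PosDef.one.smul (div_pos (Nat.cast_pos.2 (hs0 _)) hGpos)
    · refine (hX b).smul_one_sub_of_trace_le ?_
      rw [le_div_iff₀ hGpos, mul_comm]
      refine le_trans (mul_le_mul_of_nonneg_left ?_ hGpos.le) (hst (g b))
      exact Finset.single_le_sum (f := fun b => (X b).trace) (fun b _ => (hX b).trace_nonneg)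
        (by simp)
    · have e1 : ∑ b, (F s b).trace = ∑ c, ∑ b with g b = c, (s (g b) : ℝ) / G * h := by
        rw [Finset.sum_fiberwise]
        exact Finset.sum_congr rfl fun b _ => by simp [F, trace_smul]
      have e2 : ∀ c, ∑ b with g b = c, (s (g b) : ℝ) / G * h ≤ s c * (q / G * h) := by
        intro c
        have : ∑ b with g b = c, (s (g b) : ℝ) / G * h =
            ∑ b with g b = c, (s c : ℝ) / G * h :=
          Finset.sum_congr rfl fun b hb => by rw [(Finset.mem_filter.1 hb).2]
        rw [this, Finset.sum_const, nsmul_eq_mul]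
        have hcard : ((Finset.univ.filter fun b => g b = c).card : ℝ) ≤ q := by
          have := card_fin_div_eq_le k hq (c : ℕ)
          simp only [g, Fin.ext_iff]
          exact_mod_cast this
        calc _ ≤ (q : ℝ) * ((s c : ℝ) / G * h) :=
              mul_le_mul_of_nonneg_right hcard (by positivity)
          _ = _ := by ring
      rw [e1]
      refine (Finset.sum_le_sum fun c _ => e2 c).trans ?_
      rw [← Finset.sum_mul]
      have hs' : ∑ c, (s c : ℝ) ≤ 2 * G := by
        have : ((∑ c, s c : ℕ) : ℝ) ≤ ((G + G : ℕ) : ℝ) := Nat.cast_le.2 hs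
        push_cast at this
        linarith
      calc _ ≤ (2 * G : ℝ) * (q / G * h) := mul_le_mul_of_nonneg_right hs' (by positivity)
        _ = 2 * h * q := by field_simp)
  refine ⟨T, hT, hTcard.trans (Finset.card_image_le.trans (hScard.trans (le_of_eq ?_)))⟩
  rw [Fintype.card_fin]
  congr 1
  ring

/-! ### Coverings in finite-dimensional normed spaces -/

/-- In a normed space of dimension `d`, a ball can be covered by `5 ^ d` balls of half the
radius. -/
theorem exists_finset_half_cover (E : Type*) [NormedAddCommGroup E] [NormedSpace ℝ E]
    [FiniteDimensional ℝ E] {ρ : ℝ} (hρ : 0 ≤ ρ) :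
    ∃ N : Finset E, N.card ≤ 5 ^ Module.finrank ℝ E ∧
      ∀ x, ‖x‖ ≤ ρ → ∃ y ∈ N, ‖x - y‖ ≤ ρ / 2 := by
  classical
  rcases hρ.eq_or_lt with rfl | hρ
  · refine ⟨{0}, by simpa using Nat.one_le_pow _ _ (by norm_num), fun x hx => ⟨0, by simp, ?_⟩⟩
    simpa using hx
  by_contra! hcon
  -- Without a cover, a `1`-separated set in the ball of radius `2` (everything scaled by `2 / ρ`)
  -- could be enlarged forever, against the packing bound `5 ^ d`.
  have key : ∀ n : ℕ, ∃ s : Finset E, s.card = n ∧ (∀ c ∈ s, ‖c‖ ≤ 2) ∧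
      ∀ c ∈ s, ∀ d ∈ s, c ≠ d → 1 ≤ ‖c - d‖ := by
    intro n
    induction n with
    | zero => exact ⟨∅, by simp⟩
    | succ n ih =>
      obtain ⟨s, hs, hs2, hsep⟩ := ih
      have hle := Besicovitch.card_le_of_separated s hs2 hsep
      obtain ⟨x, hx, hxs⟩ := hcon (s.image fun c => (ρ / 2) • c) (Finset.card_image_le.trans hle)
      have hρ2 : (0 : ℝ) < 2 / ρ := by positivity
      have hdist : ∀ c ∈ s, 1 ≤ ‖(2 / ρ) • x - c‖ := by
        intro c hc
        have h := hxs _ (Finset.mem_image_of_mem _ hc)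
        have e : (2 / ρ) • x - c = (2 / ρ) • (x - (ρ / 2) • c) := by
          rw [smul_sub, smul_smul]
          congr 1
          rw [show 2 / ρ * (ρ / 2) = 1 by field_simp, one_smul]
        rw [e, norm_smul, Real.norm_of_nonneg hρ2.le]
        calc (1 : ℝ) = 2 / ρ * (ρ / 2) := by field_simp
          _ ≤ _ := mul_le_mul_of_nonneg_left h.le hρ2.le
      refine ⟨insert ((2 / ρ) • x) s, ?_, ?_, ?_⟩
      · rw [Finset.card_insert_of_notMem, hs]
        intro hmem
        have := hdist _ hmem
        simp at this
        linarith
      · intro c hc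
        rcases Finset.mem_insert.1 hc with rfl | hc
        · rw [norm_smul, Real.norm_of_nonneg hρ2.le]
          calc _ ≤ 2 / ρ * ρ := mul_le_mul_of_nonneg_left hx hρ2.le
            _ = 2 := by field_simp
        · exact hs2 c hc
      · intro c hc d hd hcd
        rcases Finset.mem_insert.1 hc with rfl | hc <;> rcases Finset.mem_insert.1 hd with rfl | hd
        · exact absurd rfl hcd
        · exact hdist d hd
        · rw [norm_sub_rev]; exact hdist c hc
        · exact hsep c hc d hd hcd
  obtain ⟨s, hs, hs2, hsep⟩ := key (5 ^ Module.finrank ℝ E + 1)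
  have := Besicovitch.card_le_of_separated s hs2 hsep
  omega

theorem exists_finset_cover (E : Type*) [NormedAddCommGroup E] [NormedSpace ℝ E]
    [FiniteDimensional ℝ E] {ρ : ℝ} (hρ : 0 ≤ ρ) (p : ℕ) :
    ∃ N : Finset E, N.card ≤ 5 ^ (p * Module.finrank ℝ E) ∧
      ∀ x, ‖x‖ ≤ ρ → ∃ y ∈ N, ‖x - y‖ ≤ ρ / 2 ^ p := by
  classical
  induction p with
  | zero => exact ⟨{0}, by simp, fun x hx => ⟨0, by simp, by simpa using hx⟩⟩
  | succ p ih =>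
    obtain ⟨N, hN, hcov⟩ := ih
    obtain ⟨N', hN', hcov'⟩ := exists_finset_half_cover E (ρ := ρ / 2 ^ p) (by positivity)
    refine ⟨(N ×ˢ N').image fun y => y.1 + y.2, ?_, fun x hx => ?_⟩
    · refine Finset.card_image_le.trans ?_
      rw [Finset.card_product, Nat.add_mul, one_mul, pow_add]
      exact Nat.mul_le_mul hN hN'
    · obtain ⟨y, hy, hxy⟩ := hcov x hx
      obtain ⟨z, hz, hxz⟩ := hcov' _ hxy
      refine ⟨y + z, Finset.mem_image.2 ⟨(y, z), Finset.mk_mem_product hy hz, rfl⟩, ?_⟩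
      rw [← sub_sub]
      refine hxz.trans (le_of_eq ?_)
      rw [pow_succ, div_div]

/-! ### Frobenius and operator norms -/

section MatrixNorms

variable {m n : Type*} [Fintype m] [Fintype n]

section

attribute [local instance] Matrix.frobeniusNormedAddCommGroup Matrix.frobeniusNormedSpace

/-- The Frobenius norm of a real matrix. -/
noncomputable def frobNorm (M : Matrix m n ℝ) : ℝ := ‖M‖

theorem frobNorm_nonneg (M : Matrix m n ℝ) : 0 ≤ frobNorm M := norm_nonneg M

theorem frobNorm_sq (M : Matrix m n ℝ) : frobNorm M ^ 2 = ∑ i, ∑ j, M i j ^ 2 := by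
  rw [frobNorm, frobenius_norm_def, ← Real.sqrt_eq_rpow, Real.sq_sqrt (by positivity)]
  simp

theorem frobNorm_add_le (M N : Matrix m n ℝ) : frobNorm (M + N) ≤ frobNorm M + frobNorm N :=
  norm_add_le M N

theorem frobNorm_sub_le (M N : Matrix m n ℝ) : frobNorm (M - N) ≤ frobNorm M + frobNorm N :=
  norm_sub_le M N

theorem exists_finset_frobNorm_cover {ρ : ℝ} (hρ : 0 ≤ ρ) (p : ℕ) :
    ∃ N : Finset (Matrix m n ℝ), N.card ≤ 5 ^ (p * (Fintype.card m * Fintype.card n)) ∧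
      ∀ x, frobNorm x ≤ ρ → ∃ y ∈ N, frobNorm (x - y) ≤ ρ / 2 ^ p := by
  have := exists_finset_cover (Matrix m n ℝ) hρ p
  rw [Module.finrank_matrix, Module.finrank_self, mul_one] at this
  exact this

end

section

variable [DecidableEq n]

open scoped Matrix.Norms.L2Operator

/-- The norm of a real matrix as an operator between Euclidean spaces. -/
noncomputable def l2OpNorm (M : Matrix m n ℝ) : ℝ := ‖M‖

theorem l2OpNorm_nonneg (M : Matrix m n ℝ) : 0 ≤ l2OpNorm M := norm_nonneg M

theorem l2OpNorm_add_le (M N : Matrix m n ℝ) : l2OpNorm (M + N) ≤ l2OpNorm M + l2OpNorm N :=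
  norm_add_le M N

theorem l2OpNorm_sub_le (M N : Matrix m n ℝ) : l2OpNorm (M - N) ≤ l2OpNorm M + l2OpNorm N :=
  norm_sub_le M N

theorem exists_finset_l2OpNorm_cover {ρ : ℝ} (hρ : 0 ≤ ρ) (p : ℕ) :
    ∃ N : Finset (Matrix m n ℝ), N.card ≤ 5 ^ (p * (Fintype.card m * Fintype.card n)) ∧
      ∀ x, l2OpNorm x ≤ ρ → ∃ y ∈ N, l2OpNorm (x - y) ≤ ρ / 2 ^ p := by
  have := exists_finset_cover (Matrix m n ℝ) hρ p
  rw [Module.finrank_matrix, Module.finrank_self, mul_one] at this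
  exact this

theorem sum_mulVec_sq_le (M : Matrix m n ℝ) (x : n → ℝ) :
    ∑ i, (M *ᵥ x) i ^ 2 ≤ l2OpNorm M ^ 2 * ∑ j, x j ^ 2 := by
  have h := l2_opNorm_mulVec M (WithLp.toLp 2 x)
  have h2 := pow_le_pow_left₀ (norm_nonneg _) h 2
  rw [mul_pow, EuclideanSpace.norm_sq_eq, EuclideanSpace.norm_sq_eq] at h2
  simpa [l2OpNorm] using h2

theorem l2OpNorm_le {M : Matrix m n ℝ} {c : ℝ} (hc : 0 ≤ c)
    (h : ∀ x : n → ℝ, ∑ i, (M *ᵥ x) i ^ 2 ≤ c ^ 2 * ∑ j, x j ^ 2) : l2OpNorm M ≤ c := by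
  rw [l2OpNorm, l2_opNorm_def]
  refine ContinuousLinearMap.opNorm_le_bound _ hc fun x => ?_
  refine le_of_pow_le_pow_left₀ two_ne_zero (mul_nonneg hc (norm_nonneg _)) ?_
  rw [mul_pow, EuclideanSpace.norm_sq_eq, EuclideanSpace.norm_sq_eq]
  simpa using h x.ofLp

theorem l2OpNorm_le_frobNorm (M : Matrix m n ℝ) : l2OpNorm M ≤ frobNorm M := by
  refine l2OpNorm_le (frobNorm_nonneg M) fun x => ?_
  rw [frobNorm_sq, Finset.sum_mul]
  exact Finset.sum_le_sum fun i _ => Finset.sum_mul_sq_le_sq_mul_sq _ _ _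

/-- The rows of `U * Wᵀ` are the images under `W` of the rows of `U`. -/
theorem frobNorm_mul_transpose_le {l : Type*} [Fintype l] (U : Matrix l n ℝ) (W : Matrix m n ℝ) :
    frobNorm (U * Wᵀ) ≤ frobNorm U * l2OpNorm W := by
  refine le_of_pow_le_pow_left₀ two_ne_zero (mul_nonneg (frobNorm_nonneg _) (l2OpNorm_nonneg _)) ?_
  rw [mul_pow, frobNorm_sq, frobNorm_sq, mul_comm, Finset.mul_sum]
  refine Finset.sum_le_sum fun i _ => ?_
  refine le_trans (le_of_eq ?_) (sum_mulVec_sq_le W (U i))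
  refine Finset.sum_congr rfl fun j _ => ?_
  rw [mul_apply, mulVec, dotProduct]
  congr 1
  exact Finset.sum_congr rfl fun k _ => by rw [transpose_apply, mul_comm]

end

end MatrixNorms

/-! ### Covering the Frobenius ball in operator norm -/

section

variable {m n : Type*} [Fintype m] [Fintype n]

theorem Matrix.sum_mulVec_sq_eq (A : Matrix m n ℝ) (x : n → ℝ) :
    ∑ i, (A *ᵥ x) i ^ 2 = x ⬝ᵥ ((Aᵀ * A) *ᵥ x) := by
  rw [← mulVec_mulVec, dotProduct_mulVec, vecMul_transpose, dotProduct]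
  exact Finset.sum_congr rfl fun i _ => sq _

theorem frobNorm_sq_eq_trace (A : Matrix m n ℝ) : frobNorm A ^ 2 = (Aᵀ * A).trace := by
  rw [frobNorm_sq, trace, Finset.sum_comm]
  refine Finset.sum_congr rfl fun j _ => ?_
  rw [diag_apply, mul_apply]
  exact Finset.sum_congr rfl fun i _ => by rw [transpose_apply, sq]

variable [DecidableEq n]

/-- Truncation of the singular value decomposition: a matrix of Frobenius norm at most `ρ` is the
sum of a product of two matrices with at most `d` columns and a matrix of operator norm at
most `ρ / √d`. -/
theorem exists_low_rank_approximation {M : Matrix m n ℝ} {ρ c : ℝ} {d : ℕ}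
    (hM : frobNorm M ≤ ρ) (hc : 0 ≤ c) (hcd : ρ ^ 2 ≤ c ^ 2 * d) :
    ∃ I : Finset n, I.card ≤ d ∧ ∃ (U : Matrix m I ℝ) (W : Matrix n I ℝ),
      frobNorm U ≤ ρ ∧ l2OpNorm W ≤ 1 ∧ l2OpNorm (M - U * Wᵀ) ≤ c := by
  have hpsd : (Mᵀ * M).PosSemidef := by
    have := posSemidef_conjTranspose_mul_self M
    rwa [conjTranspose_eq_transpose_of_trivial] at this
  obtain ⟨V, hV, hV', hMV, -⟩ := hpsd.isHermitian.exists_orthogonal_diagonalization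
  set l := hpsd.isHermitian.eigenvalues with hl
  have hl0 : ∀ i, 0 ≤ l i := hpsd.eigenvalues_nonneg
  have hρ0 : 0 ≤ ρ := (frobNorm_nonneg M).trans hM
  have hlsum : ∑ i, l i ≤ ρ ^ 2 := by
    have h1 := hpsd.isHermitian.trace_eq_sum_eigenvalues
    rw [← frobNorm_sq_eq_trace] at h1
    have h2 := pow_le_pow_left₀ (frobNorm_nonneg M) hM 2
    rw [h1] at h2
    simpa using h2
  set B := M * V with hB
  have hBB : Bᵀ * B = diagonal l := by
    have : Bᵀ * B = Vᵀ * (Mᵀ * M) * V := by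
      rw [hB, transpose_mul]; simp only [Matrix.mul_assoc]
    rw [this, hMV]
    simp only [← Matrix.mul_assoc]
    rw [hV, Matrix.one_mul, Matrix.mul_assoc, hV, Matrix.mul_one]
  have hMB : M = B * Vᵀ := by rw [hB, Matrix.mul_assoc, hV', Matrix.mul_one]
  -- The singular values above `c`: their squares sum to at most `ρ ^ 2 ≤ c ^ 2 * d`, so there are
  -- at most `d` of them.
  let I : Finset n := Finset.univ.filter fun i => c ^ 2 < l i
  refine ⟨I, ?_, B.submatrix id (fun i : I => (i : n)), V.submatrix id (fun i : I => (i : n)),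
    ?_, ?_, ?_⟩
  · by_contra! hcard
    have hne : I.Nonempty := Finset.card_pos.1 (by omega)
    have h1 : ∑ i ∈ I, c ^ 2 < ∑ i ∈ I, l i :=
      Finset.sum_lt_sum_of_nonempty hne fun i hi => (Finset.mem_filter.1 hi).2
    have h2 : ∑ i ∈ I, l i ≤ ∑ i, l i :=
      Finset.sum_le_sum_of_subset_of_nonneg (Finset.subset_univ _) fun i _ _ => hl0 i
    rw [Finset.sum_const, nsmul_eq_mul] at h1
    have h3 : (d : ℝ) ≤ I.card := by exact_mod_cast hcard.le
    nlinarith [sq_nonneg c]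
  · refine le_of_sq_le_sq (le_trans ?_ hlsum) hρ0
    have h1 : ∑ i, l i = ∑ i, ∑ j, B i j ^ 2 := by
      rw [← frobNorm_sq, frobNorm_sq_eq_trace, hBB, trace_diagonal]
    rw [h1, frobNorm_sq]
    refine Finset.sum_le_sum fun i _ => ?_
    simp only [submatrix_apply, id_eq]
    rw [Finset.sum_coe_sort I fun j => B i j ^ 2]
    exact Finset.sum_le_sum_of_subset_of_nonneg (Finset.subset_univ _) fun j _ _ => sq_nonneg _
  · refine l2OpNorm_le zero_le_one fun x => le_of_eq ?_
    have : (V.submatrix id (fun i : I => (i : n)))ᵀ * V.submatrix id (fun i : I => (i : n)) =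
        1 := by
      rw [transpose_submatrix, ← submatrix_mul _ _ _ id _ Function.bijective_id]
      rw [hV, submatrix_one _ Subtype.val_injective]
    rw [sum_mulVec_sq_eq, this, one_mulVec, dotProduct, one_pow, one_mul]
    exact Finset.sum_congr rfl fun i _ => (sq _).symm
  · refine l2OpNorm_le hc fun x => ?_
    set y := Vᵀ *ᵥ x with hy
    have hyx : ∑ i, y i ^ 2 = ∑ i, x i ^ 2 := by
      rw [hy, sum_mulVec_sq_eq, transpose_transpose, hV', one_mulVec, dotProduct]
      exact Finset.sum_congr rfl fun i _ => (sq _).symm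
    have e : (M - B.submatrix id (fun i : I => (i : n)) *
        (V.submatrix id (fun i : I => (i : n)))ᵀ) *ᵥ x =
          B *ᵥ (fun i => if i ∈ I then 0 else y i) := by
      have h1 : B.submatrix id (fun i : I => (i : n)) *ᵥ
          ((V.submatrix id (fun i : I => (i : n)))ᵀ *ᵥ x) =
          B *ᵥ (fun i => if i ∈ I then y i else 0) := by
        funext a
        simp only [mulVec, dotProduct, submatrix_apply, id_eq, transpose_apply, mul_ite, mul_zero]
        rw [Finset.sum_ite_mem, Finset.univ_inter,
          Finset.sum_coe_sort I fun j => B a j * ∑ k, V k j * x k]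
        rfl
      rw [sub_mulVec, ← mulVec_mulVec, h1]
      conv_lhs => rw [hMB]
      rw [← mulVec_mulVec, ← hy, ← mulVec_sub]
      congr 1
      funext i
      by_cases hi : i ∈ I <;> simp [hi]
    rw [e, sum_mulVec_sq_eq, hBB, ← hyx, dotProduct, Finset.mul_sum]
    refine Finset.sum_le_sum fun i _ => ?_
    rw [mulVec_diagonal]
    by_cases hi : i ∈ I
    · simp only [hi, if_true]
      have := mul_nonneg (sq_nonneg c) (sq_nonneg (y i))
      simpa using this
    · simp only [hi, if_false]
      have : l i ≤ c ^ 2 := by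
        by_contra! h
        exact hi (Finset.mem_filter.2 ⟨Finset.mem_univ _, h⟩)
      nlinarith [mul_le_mul_of_nonneg_right this (sq_nonneg (y i))]

/-- Matrices of Frobenius norm at most `ρ` and with a bounded number of columns, multiplied by
contractions, are approximated in Frobenius norm by a finite set. -/
theorem exists_finset_mul_transpose_cover {ρ : ℝ} (hρ : 0 ≤ ρ) (d : ℕ) :
    ∃ N : Finset (Matrix n n ℝ), N.card ≤ 5 ^ (Fintype.card n + 10 * (Fintype.card n * d)) ∧
      ∀ I : Finset n, I.card ≤ d → ∀ U W : Matrix n I ℝ, frobNorm U ≤ ρ → l2OpNorm W ≤ 1 →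
        ∃ A ∈ N, frobNorm (U * Wᵀ - A) ≤ ρ / 8 := by
  classical
  -- Relative accuracy `2 ^ (-5)` in both factors gives total error `ρ / 32 + (33 / 32) * ρ / 32 ≤ ρ
  -- / 8`. The choice of `I` contributes `2 ^ card n ≤ 5 ^ card n`.
  choose NU hNU hU using fun I : Finset n => exists_finset_frobNorm_cover (m := n) (n := I) hρ 5
  choose NW hNW hW using fun I : Finset n =>
    exists_finset_l2OpNorm_cover (m := n) (n := I) zero_le_one 5
  refine ⟨(Finset.univ.filter fun I : Finset n => I.card ≤ d).biUnion fun I =>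
    (NU I ×ˢ NW I).image fun p => p.1 * p.2ᵀ, ?_, fun I hI U W hUρ hW1 => ?_⟩
  · refine (Finset.card_biUnion_le_card_mul _ _ (5 ^ (10 * (Fintype.card n * d)))
      fun I hI => ?_).trans ?_
    · refine Finset.card_image_le.trans ?_
      rw [Finset.card_product]
      refine (Nat.mul_le_mul (hNU I) (hNW I)).trans ?_
      rw [← pow_add, Fintype.card_coe]
      refine Nat.pow_le_pow_right (by norm_num) ?_
      have := Nat.mul_le_mul_left (Fintype.card n) (Finset.mem_filter.1 hI).2
      omega
    · rw [pow_add]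
      refine Nat.mul_le_mul_right _ ((Finset.card_filter_le _ _).trans ?_)
      rw [Finset.card_univ, Fintype.card_finset]
      exact Nat.pow_le_pow_left (by norm_num) _
  · obtain ⟨U', hU', hUU'⟩ := hU I U hUρ
    obtain ⟨W', hW', hWW'⟩ := hW I W hW1
    refine ⟨U' * W'ᵀ, Finset.mem_biUnion.2 ⟨I, by simpa using hI, Finset.mem_image.2
      ⟨(U', W'), Finset.mk_mem_product hU' hW', rfl⟩⟩, ?_⟩
    have e : U * Wᵀ - U' * W'ᵀ = (U - U') * Wᵀ + (U - (U - U')) * (W - W')ᵀ := by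
      rw [transpose_sub, sub_sub_cancel, Matrix.sub_mul, Matrix.mul_sub]
      abel
    have h1 := frobNorm_mul_transpose_le (U - U') W
    have h2 := frobNorm_mul_transpose_le (U - (U - U')) (W - W')
    have h3 := frobNorm_sub_le U (U - U')
    have h4 := frobNorm_nonneg (U - U')
    have h5 := frobNorm_nonneg (U - (U - U'))
    have h6 := l2OpNorm_nonneg W
    have h7 := l2OpNorm_nonneg (W - W')
    rw [e]
    refine (frobNorm_add_le _ _).trans ?_
    have h8 : frobNorm (U - U') * l2OpNorm W ≤ ρ / 2 ^ 5 * 1 :=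
      mul_le_mul hUU' hW1 h6 (by positivity)
    have h9 : frobNorm (U - (U - U')) * l2OpNorm (W - W') ≤ (ρ + ρ / 2 ^ 5) * (1 / 2 ^ 5) :=
      mul_le_mul (by linarith) hWW' h7 (by positivity)
    linarith

variable (n) in
/-- The ball of radius `ρ` of the Frobenius norm is covered by `exp (O (card n * 4 ^ j))` balls of
radius `2 ρ / 2 ^ j` of the operator norm. -/
theorem exists_finset_frobNorm_l2OpNorm_cover (j : ℕ) {ρ : ℝ} (hρ : 0 ≤ ρ) :
    ∃ N : Finset (Matrix n n ℝ), N.card ≤ 5 ^ (14 * (Fintype.card n * 4 ^ j)) ∧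
      ∀ M : Matrix n n ℝ, frobNorm M ≤ ρ → ∃ A ∈ N, l2OpNorm (M - A) ≤ 2 * ρ / 2 ^ j := by
  classical
  induction j generalizing ρ with
  | zero =>
    refine ⟨{0}, by simpa using Nat.one_le_pow _ _ (by norm_num), fun M hM => ⟨0, by simp, ?_⟩⟩
    rw [sub_zero]
    have := l2OpNorm_le_frobNorm M
    norm_num
    linarith
  | succ j ih =>
    -- Rank `4 ^ (j + 1)` leaves operator error `ρ / 2 ^ (j + 1)`. The Frobenius remainder `ρ / 8`
    -- is covered at scale `j`, with error `ρ / (4 * 2 ^ j)`; together this is below `ρ / 2 ^ j`.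
    obtain ⟨N₁, hN₁, h₁⟩ := exists_finset_mul_transpose_cover (n := n) hρ (4 ^ (j + 1))
    obtain ⟨N₂, hN₂, h₂⟩ := ih (ρ := ρ / 8) (by positivity)
    refine ⟨(N₁ ×ˢ N₂).image fun p => p.1 + p.2, ?_, fun M hM => ?_⟩
    · refine Finset.card_image_le.trans ?_
      rw [Finset.card_product]
      refine (Nat.mul_le_mul hN₁ hN₂).trans ?_
      rw [← pow_add]
      refine Nat.pow_le_pow_right (by norm_num) ?_
      have h1 : 1 ≤ 4 ^ j := Nat.one_le_pow _ _ (by norm_num)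
      rw [pow_succ]
      nlinarith [Nat.zero_le (Fintype.card n), Nat.mul_le_mul_left (Fintype.card n) h1]
    · obtain ⟨I, hI, U, W, hU, hW, hUW⟩ := exists_low_rank_approximation (c := ρ / 2 ^ (j + 1))
        (d := 4 ^ (j + 1)) hM (by positivity) (by
          push_cast
          rw [div_pow, ← pow_mul, mul_comm (j + 1), pow_mul]
          norm_num)
      obtain ⟨A, hA, hUA⟩ := h₁ I hI U W hU hW
      obtain ⟨B, hB, hAB⟩ := h₂ _ hUA
      refine ⟨A + B, Finset.mem_image.2 ⟨(A, B), Finset.mk_mem_product hA hB, rfl⟩, ?_⟩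
      have e : M - (A + B) = (M - U * Wᵀ) + (U * Wᵀ - A - B) := by abel
      rw [e]
      refine (l2OpNorm_add_le _ _).trans ((add_le_add hUW hAB).trans ?_)
      rw [pow_succ]
      have : 0 ≤ ρ / 2 ^ j := by positivity
      have e2 : ρ / (2 ^ j * 2) + 2 * (ρ / 8) / 2 ^ j = 3 / 4 * (ρ / 2 ^ j) := by ring
      have e3 : 2 * ρ / (2 ^ j * 2) = ρ / 2 ^ j := by ring
      rw [e2, e3]
      linarith

variable (n) in
/-- For `s ≥ 1`, the unit ball of the Frobenius norm contains `exp (O (card n * s))` points whose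
distance in operator norm to any other point of the ball is at most `4 / √s`. -/
theorem exists_finset_frobNorm_unit_ball_net {s : ℕ} (hs : 0 < s) :
    ∃ N : Finset (Matrix n n ℝ), N.card ≤ 5 ^ (56 * (Fintype.card n * s)) ∧
      (∀ A ∈ N, frobNorm A ≤ 1) ∧
      ∀ M : Matrix n n ℝ, frobNorm M ≤ 1 → ∃ A ∈ N, l2OpNorm (M - A) ^ 2 ≤ 16 / s := by
  classical
  obtain ⟨j, hj1, hj2⟩ : ∃ j : ℕ, s ≤ 4 ^ j ∧ 4 ^ j ≤ 4 * s := by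
    refine ⟨Nat.clog 4 s, Nat.le_pow_clog (by norm_num) _, ?_⟩
    rcases Nat.lt_or_ge 1 s with h | h
    · have h1 := Nat.pow_pred_clog_lt_self (b := 4) (by norm_num) h
      have h2 : 0 < Nat.clog 4 s := Nat.clog_pos (by norm_num) h
      obtain ⟨t, ht⟩ := Nat.exists_eq_succ_of_ne_zero h2.ne'
      rw [ht] at h1 ⊢
      rw [Nat.pred_succ] at h1
      rw [pow_succ]
      omega
    · rw [Nat.clog_of_right_le_one h]
      omega
  obtain ⟨N, hN, hcov⟩ := exists_finset_frobNorm_l2OpNorm_cover n j zero_le_one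
  let P : Matrix n n ℝ → Matrix n n ℝ → Prop := fun A M =>
    frobNorm M ≤ 1 ∧ l2OpNorm (M - A) ≤ 2 * 1 / 2 ^ j
  -- Centers may lie outside the unit ball; each useful one is replaced by a ball point that it
  -- covers, which doubles the radius.
  let f : Matrix n n ℝ → Matrix n n ℝ := fun A => if h : ∃ M, P A M then h.choose else 0
  have hf : ∀ A M, P A M → P A (f A) := fun A M h => by
    have hex : ∃ M, P A M := ⟨M, h⟩
    simp only [f, dif_pos hex]
    exact hex.choose_spec
  refine ⟨(N.filter fun A => ∃ M, P A M).image f, ?_, fun A hA => ?_, fun M hM => ?_⟩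
  · refine (Finset.card_image_le.trans (Finset.card_filter_le _ _)).trans (hN.trans ?_)
    refine Nat.pow_le_pow_right (by norm_num) ?_
    have := Nat.mul_le_mul_left (Fintype.card n) hj2
    nlinarith
  · obtain ⟨B, hB, rfl⟩ := Finset.mem_image.1 hA
    obtain ⟨M, hM⟩ := (Finset.mem_filter.1 hB).2
    exact (hf B M hM).1
  · obtain ⟨A, hA, hMA⟩ := hcov M hM
    refine ⟨f A, Finset.mem_image_of_mem _ (Finset.mem_filter.2 ⟨hA, M, hM, hMA⟩), ?_⟩
    have h1 := (hf A M ⟨hM, hMA⟩).2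
    have e : M - f A = (M - A) - (f A - A) := by abel
    have h2 : l2OpNorm (M - f A) ≤ 4 / 2 ^ j := by
      rw [e]
      refine (l2OpNorm_sub_le _ _).trans ((add_le_add hMA h1).trans (le_of_eq ?_))
      ring
    refine (pow_le_pow_left₀ (l2OpNorm_nonneg _) h2 2).trans ?_
    rw [div_pow, ← pow_mul, mul_comm j, pow_mul]
    norm_num
    refine div_le_div_of_nonneg_left (by norm_num) (by exact_mod_cast hs) (by exact_mod_cast hj1)

end

/-! ### Majorants of single blocks and the net for `n ≥ m` -/

theorem Matrix.PosSemidef.exists_eq_transpose_mul_self {n : Type*} [Fintype n] [DecidableEq n]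
    {X : Matrix n n ℝ} (hX : X.PosSemidef) : ∃ B : Matrix n n ℝ, X = Bᵀ * B := by
  obtain ⟨V, -, -, hXV, -⟩ := hX.isHermitian.exists_orthogonal_diagonalization
  refine ⟨diagonal (fun i => √(hX.isHermitian.eigenvalues i)) * Vᵀ, ?_⟩
  rw [transpose_mul, transpose_transpose, diagonal_transpose, Matrix.mul_assoc,
    ← Matrix.mul_assoc (diagonal _) (diagonal _), diagonal_mul_diagonal, ← Matrix.mul_assoc]
  simp only [Real.mul_self_sqrt (hX.eigenvalues_nonneg _)]
  exact hXV

/-- Coordinatewise `a ^ 2 ≤ 3/2 * b ^ 2 + 3 * (a - b) ^ 2`, the difference being `(2 * a - 3 * b) ^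
2 / 2`. The factor `3/2` leaves room below `exp 1` in the final bound. -/
theorem posSemidef_perturbation {n : Type*} [Fintype n] [DecidableEq n] {M A : Matrix n n ℝ}
    {t : ℝ} (h : l2OpNorm (M - A) ^ 2 ≤ t) :
    ((3 / 2 : ℝ) • (Aᵀ * A) + (3 * t) • (1 : Matrix n n ℝ) - Mᵀ * M).PosSemidef := by
  have hsymm : ∀ B : Matrix n n ℝ, (Bᵀ * B).IsHermitian := fun B => by
    rw [IsHermitian, conjTranspose_eq_transpose_of_trivial, transpose_mul, transpose_transpose]
  refine .of_dotProduct_mulVec_nonneg (IsHermitian.sub (IsHermitian.add ?_ ?_) (hsymm M))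
    fun x => ?_
  · exact (hsymm A).smul (IsSelfAdjoint.all _)
  · exact isHermitian_one.smul (IsSelfAdjoint.all _)
  · rw [star_trivial, sub_mulVec, add_mulVec, smul_mulVec, smul_mulVec, one_mulVec,
      dotProduct_sub, dotProduct_add, dotProduct_smul, dotProduct_smul, ← sum_mulVec_sq_eq,
      ← sum_mulVec_sq_eq, smul_eq_mul, smul_eq_mul]
    have h1 := sum_mulVec_sq_le (M - A) x
    have hx : ∑ i, x i ^ 2 = x ⬝ᵥ x := Finset.sum_congr rfl fun i _ => sq _
    have h2 : l2OpNorm (M - A) ^ 2 * ∑ i, x i ^ 2 ≤ t * (x ⬝ᵥ x) := by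
      rw [← hx]
      exact mul_le_mul_of_nonneg_right h (Finset.sum_nonneg fun i _ => sq_nonneg _)
    have h3 : ∑ i, (M *ᵥ x) i ^ 2 ≤
        ∑ i, (3 / 2 * (A *ᵥ x) i ^ 2 + 3 * ((M - A) *ᵥ x) i ^ 2) := by
      refine Finset.sum_le_sum fun i _ => ?_
      rw [sub_mulVec, Pi.sub_apply]
      nlinarith [sq_nonneg (2 * (M *ᵥ x) i - 3 * (A *ᵥ x) i)]
    rw [Finset.sum_add_distrib, ← Finset.mul_sum, ← Finset.mul_sum] at h3
    linarith

/-- A finite set of matrices majorizing all positive semidefinite `h × h` matrices of trace at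
most `s / r`. -/
theorem exists_finset_majorants (h s : ℕ) {r : ℝ} (hr : 0 < r) :
    ∃ N : Finset (Matrix (Fin h) (Fin h) ℝ), N.card ≤ 5 ^ (56 * (h * s)) ∧
      (0 < s → ∀ X : Matrix (Fin h) (Fin h) ℝ, X.PosSemidef → r * X.trace ≤ s →
        ∃ Z ∈ N, Z.PosDef ∧ (Z - X).PosSemidef ∧ Z.trace ≤ 3 / 2 * (s / r) + 48 * h / r) := by
  classical
  rcases Nat.eq_zero_or_pos s with rfl | hs
  · exact ⟨∅, by simp, fun h => absurd h (lt_irrefl _)⟩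
  obtain ⟨N, hN, hN1, hcov⟩ := exists_finset_frobNorm_unit_ball_net (Fin h) hs
  have hs' : (0 : ℝ) < s := Nat.cast_pos.2 hs
  have hsr : 0 < (s : ℝ) / r := div_pos hs' hr
  -- The net error `16 / s` cancels the scaling `s / r`: the identity term is `48 / r`, independent
  -- of `s`.
  refine ⟨N.image fun A => ((s : ℝ) / r) • ((3 / 2 : ℝ) • (Aᵀ * A) +
    (3 * (16 / s : ℝ)) • (1 : Matrix (Fin h) (Fin h) ℝ)), ?_, fun _ X hX htr => ?_⟩
  · rw [Fintype.card_fin] at hN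
    exact Finset.card_image_le.trans hN
  obtain ⟨B, rfl⟩ := hX.exists_eq_transpose_mul_self
  have hfrob : ∀ A : Matrix (Fin h) (Fin h) ℝ, ∀ c : ℝ, (c • A)ᵀ * (c • A) = c ^ 2 • (Aᵀ * A) := by
    intro A c
    rw [transpose_smul, Matrix.smul_mul, Matrix.mul_smul, smul_smul, sq]
  have hsq : √(r / s) ^ 2 = r / s := Real.sq_sqrt (by positivity)
  have hM : frobNorm (√(r / s) • B) ≤ 1 := by
    refine le_of_sq_le_sq ?_ zero_le_one
    rw [frobNorm_sq_eq_trace, hfrob, hsq, trace_smul, smul_eq_mul, one_pow, div_mul_eq_mul_div,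
      div_le_one hs']
    exact htr
  obtain ⟨A, hA, hMA⟩ := hcov _ hM
  refine ⟨_, Finset.mem_image_of_mem _ hA, ?_, ?_, ?_⟩
  · refine PosDef.smul (PosDef.posSemidef_add ?_ ?_) hsr
    · have := posSemidef_conjTranspose_mul_self A
      rw [conjTranspose_eq_transpose_of_trivial] at this
      exact this.smul (by norm_num : (0 : ℝ) ≤ 3 / 2)
    · exact PosDef.one.smul (by positivity)
  · have := (posSemidef_perturbation hMA).smul hsr.le
    rw [hfrob, hsq, smul_sub, smul_smul _ (r / (s : ℝ)),
      show (s : ℝ) / r * (r / s) = 1 by field_simp, one_smul] at this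
    exact this
  · have h1 : (Aᵀ * A).trace ≤ 1 := by
      rw [← frobNorm_sq_eq_trace]
      exact pow_le_one₀ (frobNorm_nonneg _) (hN1 A hA)
    rw [trace_smul, trace_add, trace_smul, trace_smul, trace_one, Fintype.card_fin, smul_eq_mul,
      smul_eq_mul, smul_eq_mul, mul_add]
    refine add_le_add ?_ (le_of_eq (by field_simp; ring))
    nlinarith

/-- Nets that approximate each block up to an additive error of order `1 / r`. -/
theorem exists_relEntropyNet_of_block_nets {k h r : ℕ} (hr : 0 < r) {ε : ℝ}
    (hε : Real.log (3 / 2 * ((r + k) / r) + 48 * (h * k) / r) ≤ ε) :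
    ∃ T : Finset (Matrix (Fin (k * h)) (Fin (k * h)) ℝ),
      IsRelEntropyNet (T : Set (Matrix (Fin (k * h)) (Fin (k * h)) ℝ))
        (blockSpectraplex (k * h) h) ε ∧
      T.card ≤ 2 ^ (r + k + k) * 5 ^ (56 * (h * (r + k))) := by
  classical
  have hr' : (0 : ℝ) < r := Nat.cast_pos.2 hr
  obtain ⟨S, hS, hScard⟩ := exists_finset_sum_le (Fin k) (r + k)
  rw [Fintype.card_fin] at hScard
  choose N hN hcov using fun s => exists_finset_majorants h s hr'
  obtain ⟨T, hT, hTcard⟩ := exists_relEntropyNet_of_majorants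
    (S.biUnion fun s => Fintype.piFinset fun b => N (s b)) hε (by
    intro X hX hX1
    obtain ⟨s, hs0, hs, hst⟩ := exists_nat_weights (fun b => (hX b).trace_nonneg) hX1 r
    rw [Fintype.card_fin] at hs
    choose Z hZN hZ hZX hZtr using fun b => hcov (s b) (hs0 b) (X b) (hX b) (hst b)
    refine ⟨Z, Finset.mem_biUnion.2 ⟨s, (hS s).2 hs, Fintype.mem_piFinset.2 hZN⟩, hZ, hZX, ?_⟩
    refine (Finset.sum_le_sum fun b _ => hZtr b).trans ?_
    rw [Finset.sum_add_distrib, ← Finset.mul_sum, ← Finset.sum_div, Finset.sum_const,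
      Finset.card_univ, Fintype.card_fin, nsmul_eq_mul]
    have h1 : ∑ b, (s b : ℝ) ≤ r + k := by exact_mod_cast hs
    refine add_le_add (mul_le_mul_of_nonneg_left
      (div_le_div_of_nonneg_right h1 hr'.le) (by norm_num)) (le_of_eq (by ring)))
  refine ⟨T, hT, hTcard.trans ((Finset.card_biUnion_le_card_mul _ _ _ fun s hs => ?_).trans
    (Nat.mul_le_mul_right _ hScard))⟩
  rw [Fintype.card_piFinset]
  refine (Finset.prod_le_prod' fun b _ => hN (s b)).trans ?_
  rw [Finset.prod_pow_eq_pow_sum, ← Finset.mul_sum, ← Finset.mul_sum]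
  exact Nat.pow_le_pow_right (by norm_num)
    (Nat.mul_le_mul_left _ (Nat.mul_le_mul_left _ ((hS s).1 hs)))

/-! ### Choice of parameters in the two regimes -/

theorem mainTheorem6 :
    ∃ C : ℝ, 0 < C ∧
      ∀ h m n : ℕ, 0 < h → 0 < m → 0 < n → h ∣ m →
        ∃ T : Finset (Matrix (Fin m) (Fin m) ℝ),
          IsRelEntropyNet (T : Set (Matrix (Fin m) (Fin m) ℝ)) (blockSpectraplex m h)
            (max 1 (Real.log (2 * (h : ℝ) * (m : ℝ) / (n : ℝ)))) ∧
          (T.card : ℝ) ≤ (2 : ℝ) ^ (C * (n : ℝ)) := by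
  -- The larger exponent is that of the second regime: `r + 2 * k + 168 * h * (r + k) ≤ 33970 * n`,
  -- using `5 ≤ 2 ^ 3`.
  refine ⟨40000, by norm_num, fun h m n hh hm hn hdvd => ?_⟩
  have hn' : (0 : ℝ) < n := Nat.cast_pos.2 hn
  have hh' : (1 : ℝ) ≤ h := by exact_mod_cast hh
  obtain ⟨k, rfl⟩ : ∃ k, m = k * h := by
    obtain ⟨k, rfl⟩ := hdvd
    exact ⟨k, mul_comm _ _⟩
  have hk : 0 < k := Nat.pos_of_mul_pos_right hm
  have hk' : (0 : ℝ) < k := Nat.cast_pos.2 hk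
  suffices H : ∃ T : Finset (Matrix (Fin (k * h)) (Fin (k * h)) ℝ),
      IsRelEntropyNet (T : Set (Matrix (Fin (k * h)) (Fin (k * h)) ℝ)) (blockSpectraplex (k * h) h)
        (max 1 (Real.log (2 * (h : ℝ) * ((k * h : ℕ) : ℝ) / (n : ℝ)))) ∧
      T.card ≤ 2 ^ (40000 * n) by
    obtain ⟨T, hT, hcard⟩ := H
    refine ⟨T, hT, ?_⟩
    have e : (40000 : ℝ) * (n : ℝ) = ((40000 * n : ℕ) : ℝ) := by push_cast; ring
    rw [e, Real.rpow_natCast]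
    exact_mod_cast hcard
  rcases Nat.lt_or_ge n (k * h) with hlt | hge
  · set q := k * h / n with hq
    have hq0 : 0 < q := Nat.div_pos hlt.le hn
    have hqn : q * n ≤ k * h := Nat.div_mul_le_self _ _
    have hqle : (q : ℝ) ≤ ((k * h : ℕ) : ℝ) / n := by
      rw [le_div_iff₀ hn']
      exact_mod_cast hqn
    obtain ⟨T, hT, hTcard⟩ := exists_relEntropyNet_of_grouping (k := k) (h := h) (q := q) hh hq0
      (ε := max 1 (Real.log (2 * (h : ℝ) * ((k * h : ℕ) : ℝ) / (n : ℝ)))) (by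
        refine le_trans (Real.log_le_log (by positivity) ?_) (le_max_right _ _)
        rw [mul_div_assoc]
        exact mul_le_mul_of_nonneg_left hqle (by positivity))
    refine ⟨T, hT, hTcard.trans (Nat.pow_le_pow_right (by norm_num) ?_)⟩
    have h1 : k * h < (q + 1) * n := by
      have := Nat.lt_div_mul_add (a := k * h) hn
      rw [← hq] at this
      linarith
    have h2 : k / q ≤ 2 * n := by
      refine Nat.div_le_of_le_mul ?_
      nlinarith
    omega
  -- With `r * h ≥ 100 * n`, the excess of the trace bound over `3/2`, at most `50 * h * k / r`, is
  -- at most `u / 2` for `u = h ^ 2 * k / n`.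
  · set r := 100 * (n / h + 1) with hr
    have hhk : h * k ≤ n := by rw [mul_comm]; exact hge
    have hhn : h ≤ n := (Nat.le_mul_of_pos_left h hk).trans hge
    have hkn : k ≤ n := (Nat.le_mul_of_pos_right k hh).trans hge
    have hr1 : 100 * n ≤ r * h := by
      have := Nat.lt_div_mul_add (a := n) hh
      rw [hr]
      nlinarith
    have hr2 : r * h ≤ 200 * n := by
      have := Nat.div_mul_le_self n h
      rw [hr]
      nlinarith
    have hr0 : 0 < r := by rw [hr]; positivity
    have hr0' : (0 : ℝ) < r := Nat.cast_pos.2 hr0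
    have hr1' : (100 * n : ℝ) ≤ r * h := by exact_mod_cast hr1
    obtain ⟨T, hT, hTcard⟩ := exists_relEntropyNet_of_block_nets (k := k) (h := h) (r := r) hr0
      (ε := max 1 (Real.log (2 * (h : ℝ) * ((k * h : ℕ) : ℝ) / (n : ℝ)))) (by
        set u : ℝ := h * (h * k) / n with hu
        have hτ : 3 / 2 * (((r : ℝ) + k) / r) + 48 * (h * k) / r ≤ 3 / 2 + u / 2 := by
          have e : 3 / 2 * (((r : ℝ) + k) / r) + 48 * (h * k) / r =
              3 / 2 + (3 / 2 * k + 48 * (h * k)) / r := by field_simp; ring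
          rw [e]
          refine add_le_add_right ?_ _
          rw [hu, div_div, div_le_div_iff₀ hr0' (by positivity)]
          have h1 : (k : ℝ) ≤ h * k := le_mul_of_one_le_left hk'.le hh'
          have h2 : (3 / 2 * k + 48 * (h * k) : ℝ) * (n * 2) ≤ 50 * (h * k) * (n * 2) :=
            mul_le_mul_of_nonneg_right (by linarith) (by positivity)
          have h3 : (h * k : ℝ) * (100 * n) ≤ h * k * (r * h) :=
            mul_le_mul_of_nonneg_left hr1' (by positivity)
          linarith
        have hpos : 0 < 3 / 2 * (((r : ℝ) + k) / r) + 48 * (h * k) / r := by positivity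
        have e2 : 2 * (h : ℝ) * ((k * h : ℕ) : ℝ) / (n : ℝ) = 2 * u := by
          rw [hu]; push_cast; ring
        rw [e2]
        -- For `u ≤ 1` the bound `3/2 + u/2` is at most `2 < exp 1`; for `u ≥ 1` it is at most `2 *
        -- u`, which is `2hm/n`.
        rcases le_total u 1 with h1 | h1
        · refine le_trans ?_ (le_max_left _ _)
          rw [Real.log_le_iff_le_exp hpos]
          have := Real.exp_one_gt_d9
          linarith
        · refine le_trans (Real.log_le_log hpos ?_) (le_max_right _ _)
          linarith)
    refine ⟨T, hT, hTcard.trans ?_⟩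
    have h1 : r ≤ 200 * n := (Nat.le_mul_of_pos_right r hh).trans hr2
    have h2 : h * (r + k) ≤ 201 * n := by nlinarith
    calc 2 ^ (r + k + k) * 5 ^ (56 * (h * (r + k)))
        ≤ 2 ^ (r + k + k) * (2 ^ 3) ^ (56 * (h * (r + k))) :=
          Nat.mul_le_mul_left _ (Nat.pow_le_pow_left (by norm_num) _)
      _ = 2 ^ (r + k + k + 3 * (56 * (h * (r + k)))) := by rw [← pow_mul, ← pow_add]
      _ ≤ 2 ^ (40000 * n) := Nat.pow_le_pow_right (by norm_num) (by omega)
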